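/- **MMD bound.** Let $\mathcal X,\mathcal Y$ be measurable spaces, let $\mathcal H$ be a measurable space of hypotheses $h:\mathcal X\to\mathcal Y$ such that $(h,x)\mapsto h(x)$ is measurable, and let $\ell:\mathcal Y\times\mathcal Y\to[0,1]$ be a measurable loss (for instance the zero-one loss). Let $\mathcal S$ (source) and $\mathcal T$ (target) be probability measures on $\mathcal X\times\mathcal Y$ with marginals $\mathcal S_x,\mathcal T_x$ on $\mathcal X$, and assume covariate shift: some Markov kernel $\kappa$ from $\mathcal X$ to $\mathcal Y$ is a regular conditional distribution of $Y$ given $X$ both under $\mathcal S$ and under $\mathcal T$. For $h\in\mathcal H$ let $\overline\ell_h(x)=\int \ell(h(x),y)\,\kappa(x,dy)=\mathbb E[\ell(h(x),Y)\mid X=x]$ be the expected pointwise loss. Let $\mathcal L$ be a reproducing kernel Hilbert space of real functions on $\mathcal X$ whose reproducing kernel $k$ is measurable on $\mathcal X\times\mathcal X$ and satisfies $0\le k(x,x')\le K$ for all $x,x'\in\mathcal X$. Assume that the expected pointwise losses lie in the unit ball of $\mathcal L$: for every $h\in\mathcal H$ there is $f\in\mathcal L$ with $\|f\|_{\mathcal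 L}\le 1$ and $\overline\ell_h=f$ almost everywhere with respect to $\mathcal S_x$ and to $\mathcal T_x$. Let $\pi$ be a probability measure on $\mathcal H$ (the prior), $m\ge 1$ and $\gamma,\delta\in(0,1)$. Then, with probability at least $1-\delta$ over independent samples $S=((x_i,y_i))_{i=1}^m\sim\mathcal S^m$ and $S'_x=(x'_i)_{i=1}^m\sim\mathcal T_x^m$, simultaneously for all probability measures $\rho$ on $\mathcal H$ (posteriors, which may thus depend on the samples) with $D_{\mathrm{KL}}(\rho\|\pi)<\infty$, $$ \mathbb E_{h\sim\rho}R_{\mathcal T}(h)\le\frac1\gamma\,\mathbb E_{h\sim\rho}\hat R_{\mathcal S}(h)+\frac{D_{\mathrm{KL}}(\rho\|\pi)+\log\frac2\delta}{2\gamma(1-\gamma)m}+\widehat{\mathrm{MMD}}_k(\mathcal S,\mathcal T)+2\sqrt{\frac Km}\Bigl(2+\sqrt{\log\frac4\delta}\Bigr), $$ where $R_{\mathcal T}(h)=\mathbb E_{(x,y)\sim\mathcal T}[\ell(h(x),y)]$, $\hat R_{\mathcal S}(h)=\frac1m\sum_{i=1}^m\ell(h(x_i),y_i)$, and $$ \widehat{\mathrm{MMD}}_k(\mathcal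 S,\mathcal T)=\Bigl(\frac1{m^2}\sum_{i,j=1}^m k(x_i,x_j)-\frac2{m^2}\sum_{i,j=1}^m k(x_i,x'_j)+\frac1{m^2}\sum_{i,j=1}^m k(x'_i,x'_j)\Bigr)^{1/2} $$ is the biased empirical estimate of the maximum mean discrepancy. -/

import Mathlib

open MeasureTheory ProbabilityTheory InformationTheory

noncomputable section

namespace DomainAdaptation

variable {X Y : Type*}

/-- The (real-valued) reproducing kernel `k(x, x')` of a reproducing kernel Hilbert space `L` of
real functions on `X`. Mathlib's `RKHS.kernel` takes values in the continuous linear maps `ℝ → ℝ`;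
such a map is identified with its value at `1`. -/
def reproducingKernel (L : Type*) [NormedAddCommGroup L] [InnerProductSpace ℝ L] [CompleteSpace L]
    [RKHS ℝ L X ℝ] (x x' : X) : ℝ :=
  RKHS.kernel L x x' 1

/-- The risk `R_D(h) = 𝔼_{(x, y) ∼ D} [ℓ(h(x), y)]`. -/
def risk [MeasurableSpace X] [MeasurableSpace Y] (ℓ : Y → Y → ℝ) (D : Measure (X × Y))
    (h : X → Y) : ℝ :=
  ∫ z, ℓ (h z.1) z.2 ∂D

/-- The empirical risk `(1/m) ∑ i, ℓ(h(x_i), y_i)` on a labeled sample of size `m`. -/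
def empRisk {m : ℕ} (ℓ : Y → Y → ℝ) (s : Fin m → X × Y) (h : X → Y) : ℝ :=
  1 / (m : ℝ) * ∑ i, ℓ (h (s i).1) (s i).2

/-- The Gibbs risk `𝔼_{h ∼ ρ} R_D(h)`; the hypothesis class `ℋ` is indexed through `ev`. -/
def gibbsRisk {ℋ : Type*} [MeasurableSpace ℋ] [MeasurableSpace X] [MeasurableSpace Y]
    (ev : ℋ → X → Y) (ℓ : Y → Y → ℝ) (D : Measure (X × Y)) (ρ : Measure ℋ) : ℝ :=
  ∫ h, risk ℓ D (ev h) ∂ρ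

/-- The empirical Gibbs risk. -/
def empGibbsRisk {ℋ : Type*} [MeasurableSpace ℋ] {m : ℕ}
    (ev : ℋ → X → Y) (ℓ : Y → Y → ℝ) (s : Fin m → X × Y) (ρ : Measure ℋ) : ℝ :=
  ∫ h, empRisk ℓ s (ev h) ∂ρ

/-- Covariate shift: the Markov kernel `κ` is a regular version of the conditional distribution of
the label given the input, both under the source domain `S` and under the target domain `T`. -/
structure CovariateShift [MeasurableSpace X] [MeasurableSpace Y] (S T : Measure (X × Y))
    (κ : Kernel X Y) : Prop where
  source : S = S.fst ⊗ₘ κ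
  target : T = T.fst ⊗ₘ κ

/-- The expected pointwise loss `x ↦ 𝔼[ℓ(h(x), Y) ∣ X = x]`, with `κ x` the law of `Y` given
`X = x`. -/
def pointwiseLoss [MeasurableSpace X] [MeasurableSpace Y] (ℓ : Y → Y → ℝ) (κ : Kernel X Y)
    (h : X → Y) (x : X) : ℝ :=
  ∫ y, ℓ (h x) y ∂(κ x)

/-- The biased empirical maximum mean discrepancy of two samples of size `m`: the plug-in estimate
of `MMD_k(P, Q)² = 𝔼 k(X, X') - 2 𝔼 k(X, Y) + 𝔼 k(Y, Y')`, diagonal terms included. -/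
def empMMD {m : ℕ} (k : X → X → ℝ) (x x' : Fin m → X) : ℝ :=
  √(1 / (m : ℝ) ^ 2 * ∑ i, ∑ j, k (x i) (x j)
    - 2 / (m : ℝ) ^ 2 * ∑ i, ∑ j, k (x i) (x' j)
    + 1 / (m : ℝ) ^ 2 * ∑ i, ∑ j, k (x' i) (x' j))

end DomainAdaptation

end

/-! Two independent estimates are joined by a union bound. On the source, a PAC-Bayes argument
controls the Gibbs risk: an exponential moment is at most 1 for each hypothesis, hence also after
averaging over the prior; Markov's inequality gives one event, and Donsker–Varadhan transfers the
bound to every posterior at once (`exists_pacBayes_event`). For the transfer, let `uS`, `uT` be the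
mean embeddings of the input marginals. Covariate shift makes both risks of `h` integrals of one
function, represented by some `f` in the unit ball, so they differ by `⟪f, uT - uS⟫ ≤ ‖uT - uS‖`.
The triangle inequality through the empirical embeddings, whose distance is the empirical MMD,
leaves two estimation errors. A second-moment bound controls the mean of each and McDiarmid's
inequality its deviation (`measure_norm_sum_sub_gt_le`). -/

open scoped NNReal RealInnerProductSpace

/-! ### Change of measure. -/

/-- The Donsker–Varadhan inequality. -/
theorem integral_le_klDiv_add_log_integral_exp {α : Type*} [MeasurableSpace α] {ρ π : Measure α}
    [IsProbabilityMeasure ρ] [IsProbabilityMeasure π] (hkl : klDiv ρ π ≠ ⊤) {f : α → ℝ}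
    (hfρ : Integrable f ρ) (hfπ : Integrable (fun x => Real.exp (f x)) π) :
    ∫ x, f x ∂ρ ≤ (klDiv ρ π).toReal + Real.log (∫ x, Real.exp (f x) ∂π) := by
  obtain ⟨hac, hint⟩ := klDiv_ne_top_iff.1 hkl
  have := isProbabilityMeasure_tilted hfπ
  -- The inequality is nonnegativity of the divergence of `ρ` from the tilt of `π` by `f`.
  have h1 := integral_llr_add_sub_measure_univ_nonneg
    (hac.trans (absolutelyContinuous_tilted hfπ)) (integrable_llr_tilted_right hac hfρ hint hfπ)
  rw [integral_llr_tilted_right hac hfρ hfπ hint] at h1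
  rw [toReal_klDiv_of_measure_eq hac (by simp)]
  simp at h1
  linarith

/-! ### Product measures and bounded differences. -/

theorem integrable_of_abs_le {α : Type*} [MeasurableSpace α] {μ : Measure α} [IsFiniteMeasure μ]
    {f : α → ℝ} (hf : Measurable f) {B : ℝ} (hB : ∀ x, |f x| ≤ B) : Integrable f μ :=
  .of_bound hf.aestronglyMeasurable B (.of_forall hB)

theorem measurePreserving_finCons {Ω : Type*} [MeasurableSpace Ω] (μ : Measure Ω) [SigmaFinite μ]
    (n : ℕ) :
    MeasurePreserving (fun p : Ω × (Fin n → Ω) => (Fin.cons p.1 p.2 : Fin (n + 1) → Ω))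
      (μ.prod (Measure.pi fun _ : Fin n => μ)) (Measure.pi fun _ : Fin (n + 1) => μ) := by
  convert (measurePreserving_piFinSuccAbove (fun _ : Fin (n + 1) => μ) 0).symm using 1
  ext p i
  simp [MeasurableEquiv.piFinSuccAbove_symm_apply, Fin.insertNthEquiv]

theorem integral_pi_fin_succ {Ω : Type*} [MeasurableSpace Ω] (μ : Measure Ω)
    [IsProbabilityMeasure μ] {n : ℕ} {f : (Fin (n + 1) → Ω) → ℝ} (hf : Measurable f)
    (hint : Integrable f (Measure.pi fun _ : Fin (n + 1) => μ)) :
    ∫ x, f x ∂(Measure.pi fun _ : Fin (n + 1) => μ) =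
      ∫ a, ∫ x, f (Fin.cons a x) ∂(Measure.pi fun _ : Fin n => μ) ∂μ := by
  have hmp := measurePreserving_finCons μ n
  rw [← hmp.map_eq, integral_map hmp.measurable.aemeasurable hf.aestronglyMeasurable,
    integral_prod]
  exact hmp.integrable_comp_of_integrable hint

/-- Hoeffding's lemma for a function of bounded oscillation. -/
theorem hasSubgaussianMGF_of_abs_sub_le {Ω : Type*} [MeasurableSpace Ω] (μ : Measure Ω)
    [IsProbabilityMeasure μ] {g : Ω → ℝ} (hg : Measurable g) (c : ℝ≥0)
    (hc : ∀ a b, |g a - g b| ≤ c) :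
    HasSubgaussianMGF (fun a => g a - ∫ b, g b ∂μ) ((c / 2) ^ 2) μ := by
  have : Nonempty Ω := nonempty_of_isProbabilityMeasure μ
  have hbdd : BddBelow (Set.range g) := by
    obtain ⟨b⟩ := this
    refine ⟨g b - c, ?_⟩
    rintro _ ⟨a, rfl⟩
    have := abs_le.1 (hc a b)
    linarith [this.1]
  have h := hasSubgaussianMGF_of_mem_Icc (μ := μ) (a := ⨅ a, g a) (b := (⨅ a, g a) + c)
    hg.aemeasurable (.of_forall fun a => ⟨ciInf_le hbdd a, by
      have : g a - c ≤ ⨅ a, g a := le_ciInf fun b => by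
        have := abs_le.1 (hc a b)
        linarith [this.2]
      linarith⟩)
  simpa using h

/-- **McDiarmid's inequality**: a bounded function of independent and identically distributed
variables that has bounded differences is sub-Gaussian. -/
theorem hasSubgaussianMGF_of_boundedDifferences {Ω : Type*} [MeasurableSpace Ω] (μ : Measure Ω)
    [IsProbabilityMeasure μ] (c : ℝ≥0) {B : ℝ} {n : ℕ} {f : (Fin n → Ω) → ℝ} (hf : Measurable f)
    (hB : ∀ x, |f x| ≤ B) (hc : ∀ x i a, |f (Function.update x i a) - f x| ≤ c) :
    HasSubgaussianMGF (fun x => f x - ∫ y, f y ∂(Measure.pi fun _ : Fin n => μ))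
      (n * (c / 2) ^ 2) (Measure.pi fun _ : Fin n => μ) := by
  have hint : ∀ {k : ℕ} {f : (Fin k → Ω) → ℝ}, Measurable f → (∀ x, |f x| ≤ B) → ∀ t C : ℝ,
      Integrable (fun x => Real.exp (t * (f x - C))) (Measure.pi fun _ : Fin k => μ) := by
    intro k f hf hB t C
    refine integrable_of_abs_le (B := Real.exp (|t| * (B + |C|))) (by fun_prop) fun x => ?_
    rw [Real.abs_exp, Real.exp_le_exp]
    refine (le_abs_self _).trans ?_
    rw [abs_mul]
    gcongr
    exact (abs_sub _ _).trans (by gcongr; exact hB x)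
  refine ⟨fun t => hint hf hB t _, fun t => ?_⟩
  unfold mgf
  induction n with
  | zero =>
    simp [integral_unique, Measure.real]
  | succ n ih =>
    have hcons : Measurable fun p : Ω × (Fin n → Ω) => (Fin.cons p.1 p.2 : Fin (n + 1) → Ω) :=
      (measurePreserving_finCons μ n).measurable
    have hfa : ∀ a, Measurable fun x : Fin n → Ω => f (Fin.cons a x) := fun a =>
      hf.comp (hcons.comp measurable_prodMk_left)
    -- `g` is the mean given the first coordinate and inherits oscillation at most `c`. Hoeffding's
    -- lemma handles `g` minus its mean, the induction hypothesis handles `f - g a` for fixed `a`,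
    -- and the variance proxies add.
    set g : Ω → ℝ := fun a => ∫ x, f (Fin.cons a x) ∂(Measure.pi fun _ : Fin n => μ) with hg
    have hgm : Measurable g :=
      (StronglyMeasurable.integral_prod_right' (f := fun p : Ω × (Fin n → Ω) => f (Fin.cons p.1 p.2))
        (hf.comp hcons).stronglyMeasurable).measurable
    have hfi : ∀ a, Integrable (fun x => f (Fin.cons a x)) (Measure.pi fun _ : Fin n => μ) :=
      fun a => integrable_of_abs_le (hfa a) fun x => hB _
    have hgc : ∀ a b, |g a - g b| ≤ c := by
      intro a b
      rw [hg, ← integral_sub (hfi a) (hfi b)]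
      refine (abs_integral_le_integral_abs).trans ?_
      refine (integral_mono ((hfi a).sub (hfi b)).abs (integrable_const (c : ℝ)) fun x => ?_).trans
        (by simp)
      simpa using hc (Fin.cons b x) 0 a
    have hmain := (hasSubgaussianMGF_of_abs_sub_le μ hgm c hgc)
    have hmean : ∫ y, f y ∂(Measure.pi fun _ : Fin (n + 1) => μ) = ∫ a, g a ∂μ :=
      integral_pi_fin_succ μ hf (integrable_of_abs_le hf hB)
    rw [hmean, integral_pi_fin_succ μ (by fun_prop) (hint hf hB t _)]
    have hstep : ∀ a, ∫ x, Real.exp (t * (f (Fin.cons a x) - ∫ b, g b ∂μ))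
        ∂(Measure.pi fun _ : Fin n => μ) ≤
        Real.exp ((n * (c / 2) ^ 2 : ℝ≥0) * t ^ 2 / 2) *
          Real.exp (t * (g a - ∫ b, g b ∂μ)) := by
      intro a
      have h := ih (hfa a) (fun x => hB _) (fun x i b => by
        rw [Fin.cons_update]; exact hc _ _ _)
      calc _ = ∫ x, Real.exp (t * (f (Fin.cons a x) - g a)) * Real.exp (t * (g a - ∫ b, g b ∂μ))
            ∂(Measure.pi fun _ : Fin n => μ) := by
              congr 1; ext x; rw [← Real.exp_add]; congr 1; ring
        _ ≤ _ := by
              rw [integral_mul_const]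
              gcongr
    refine (integral_mono_of_nonneg (.of_forall fun a => integral_nonneg fun x => by positivity)
      ((hmain.integrable_exp_mul t).const_mul _) (.of_forall hstep)).trans ?_
    rw [integral_const_mul]
    refine (mul_le_mul_of_nonneg_left (hmain.mgf_le t) (by positivity)).trans ?_
    rw [← Real.exp_add]
    apply le_of_eq
    congr 1
    push_cast
    ring

/-! ### The PAC-Bayes bound on the source. -/

/-- Invert `1 + a + a²/2 ≤ exp a` and use `(1 + a + a²/2)(1 - a + a²/2) = 1 + a⁴/4 ≥ 1`. -/
theorem Real.exp_neg_le_one_sub_add_sq {a : ℝ} (ha : 0 ≤ a) :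
    Real.exp (-a) ≤ 1 - a + a ^ 2 / 2 := by
  have h := Real.quadratic_le_exp_of_nonneg ha
  have hpos : 0 < 1 + a + a ^ 2 / 2 := by positivity
  have : Real.exp (-a) ≤ (1 + a + a ^ 2 / 2)⁻¹ := by
    rw [Real.exp_neg]; exact inv_anti₀ hpos h
  refine this.trans ?_
  rw [inv_le_iff_one_le_mul₀ hpos]
  nlinarith [sq_nonneg (a ^ 2)]

/-- A convex function lies below its chord, here between `0` and `-a`. -/
theorem Real.exp_neg_mul_le {a x : ℝ} (hx0 : 0 ≤ x) (hx1 : x ≤ 1) :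
    Real.exp (-a * x) ≤ 1 - (1 - Real.exp (-a)) * x := by
  have h := convexOn_exp.2 (Set.mem_univ 0) (Set.mem_univ (-a)) (sub_nonneg.2 hx1) hx0 (by ring)
  simp only [smul_eq_mul, mul_zero, zero_add, Real.exp_zero, mul_one] at h
  rw [mul_comm (-a)]
  linarith

/-- The moment generating function of a `[0, 1]`-valued variable, evaluated at `-2 (1 - γ)`. -/
theorem integral_exp_neg_mul_le {Z : Type*} [MeasurableSpace Z] (μ : Measure Z)
    [IsProbabilityMeasure μ] {g : Z → ℝ} (hg : Measurable g) (h0 : ∀ z, 0 ≤ g z)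
    (h1 : ∀ z, g z ≤ 1) {γ : ℝ} (hγ : γ ≤ 1) :
    ∫ z, Real.exp (-(2 * (1 - γ)) * g z) ∂μ ≤
      Real.exp (-(2 * (1 - γ) * γ * ∫ z, g z ∂μ)) := by
  set a := 2 * (1 - γ) with ha
  have ha0 : 0 ≤ a := by linarith
  have hgi : Integrable g μ :=
    integrable_of_abs_le hg (B := 1) fun z => abs_le.2 ⟨by linarith [h0 z], h1 z⟩
  have hR : 0 ≤ ∫ z, g z ∂μ := integral_nonneg h0
  -- The value `a = 2 (1 - γ)` is chosen so that `a - a²/2 = a γ`.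
  have hexp : a * γ ≤ 1 - Real.exp (-a) := by
    have := Real.exp_neg_le_one_sub_add_sq ha0
    have hγa : γ = 1 - a / 2 := by rw [ha]; ring
    rw [hγa]
    nlinarith
  calc _ ≤ ∫ z, (1 - (1 - Real.exp (-a)) * g z) ∂μ :=
        integral_mono_of_nonneg (.of_forall fun z => by positivity)
          ((integrable_const _).sub (hgi.const_mul _))
          (.of_forall fun z => Real.exp_neg_mul_le (h0 z) (h1 z))
    _ = 1 - (1 - Real.exp (-a)) * ∫ z, g z ∂μ := by
        rw [integral_sub (integrable_const _) (hgi.const_mul _), integral_const_mul]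
        simp
    _ ≤ 1 - a * γ * ∫ z, g z ∂μ := by
        gcongr
    _ ≤ _ := by
        have := Real.add_one_le_exp (-(a * γ * ∫ z, g z ∂μ))
        linarith

/-- A PAC-Bayesian bound for `[0, 1]`-valued losses, uniform over all posteriors. -/
theorem exists_pacBayes_event {ℋ Z : Type*} [MeasurableSpace ℋ] [MeasurableSpace Z]
    (μ : Measure Z) [IsProbabilityMeasure μ] (π : Measure ℋ) [IsProbabilityMeasure π]
    {g : ℋ → Z → ℝ} (hg : Measurable (Function.uncurry g)) (h0 : ∀ h z, 0 ≤ g h z)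
    (h1 : ∀ h z, g h z ≤ 1) {m : ℕ} (hm : 0 < m) {γ ε : ℝ} (hγ0 : 0 < γ) (hγ1 : γ < 1)
    (hε : 0 < ε) :
    ∃ A : Set (Fin m → Z), MeasurableSet A ∧
      (Measure.pi fun _ : Fin m => μ).real Aᶜ ≤ ε ∧
      ∀ s ∈ A, ∀ ρ : Measure ℋ, IsProbabilityMeasure ρ → klDiv ρ π ≠ ⊤ →
        ∫ h, ∫ z, g h z ∂μ ∂ρ ≤ 1 / γ * ∫ h, (1 / (m : ℝ) * ∑ i, g h (s i)) ∂ρ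
          + ((klDiv ρ π).toReal + Real.log (1 / ε)) / (2 * γ * (1 - γ) * m) := by
  have hmR : (0 : ℝ) < m := by exact_mod_cast hm
  set a := 2 * (1 - γ) with ha
  have ha0 : 0 < a := by rw [ha]; linarith
  set P := Measure.pi fun _ : Fin m => μ with hP
  set R : ℋ → ℝ := fun h => ∫ z, g h z ∂μ with hR
  have hRm : Measurable R := (hg.stronglyMeasurable.integral_prod_right).measurable
  have hR0 : ∀ h, 0 ≤ R h := fun h => integral_nonneg (h0 h)
  have hgm : ∀ h, Measurable (g h) := fun h => hg.comp measurable_prodMk_left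
  have hR1 : ∀ h, R h ≤ 1 := fun h =>
    (integral_mono_of_nonneg (.of_forall (h0 h)) (integrable_const (1 : ℝ))
      (.of_forall (h1 h))).trans (by simp)
  have hsum0 : ∀ h (s : Fin m → Z), 0 ≤ ∑ i, g h (s i) := fun h s =>
    Finset.sum_nonneg fun i _ => h0 _ _
  have hsum1 : ∀ h (s : Fin m → Z), ∑ i, g h (s i) ≤ m := fun h s =>
    (Finset.sum_le_sum fun i _ => h1 _ _).trans (by simp)
  set G : ℋ × (Fin m → Z) → ℝ := fun p => a * (m * γ * R p.1 - ∑ i, g p.1 (p.2 i)) with hG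
  have hsm : Measurable fun p : ℋ × (Fin m → Z) => ∑ i, g p.1 (p.2 i) :=
    Finset.measurable_sum _ fun i _ => hg.comp
      (measurable_fst.prodMk ((measurable_pi_apply i).comp measurable_snd))
  have hGm : Measurable G := by fun_prop
  have hGb : ∀ p, |G p| ≤ a * m := by
    intro p
    rw [hG, abs_mul, abs_of_pos ha0]
    refine mul_le_mul_of_nonneg_left (abs_le.2 ⟨?_, ?_⟩) ha0.le
    · have : 0 ≤ m * γ * R p.1 := mul_nonneg (by positivity) (hR0 _)
      linarith [hsum1 p.1 p.2]
    · have : m * γ * R p.1 ≤ m := by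
        rw [mul_assoc]
        exact mul_le_of_le_one_right hmR.le (mul_le_one₀ hγ1.le (hR0 _) (hR1 _))
      linarith [hsum0 p.1 p.2]
  have hEb : ∀ p, |Real.exp (G p)| ≤ Real.exp (a * m) := fun p => by
    rw [Real.abs_exp, Real.exp_le_exp]; exact (le_abs_self _).trans (hGb p)
  have hEi : Integrable (fun p => Real.exp (G p)) (π.prod P) :=
    integrable_of_abs_le hGm.exp hEb
  have hmgf : ∀ h, ∫ s, Real.exp (G (h, s)) ∂P ≤ 1 := by
    intro h
    have : ∀ s, Real.exp (G (h, s)) =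
        Real.exp (a * (m * γ * R h)) * ∏ i, Real.exp (-a * g h (s i)) := by
      intro s
      rw [← Real.exp_sum, ← Real.exp_add, ← Finset.mul_sum]
      congr 1
      simp only [hG]; ring
    simp_rw [this]
    rw [integral_const_mul, integral_fintype_prod_eq_pow (μ := μ)
      (fun z => Real.exp (-a * g h z)), Fintype.card_fin]
    calc _ ≤ Real.exp (a * (m * γ * R h)) * (Real.exp (-(a * γ * R h))) ^ m := by
          gcongr
          exact integral_exp_neg_mul_le μ (hgm h) (h0 h) (h1 h) hγ1.le
      _ = 1 := by
          rw [← Real.exp_nat_mul, ← Real.exp_add, ← Real.exp_zero]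
          congr 1; ring
  -- Averaging over the prior before applying Markov's inequality yields an event that does not
  -- depend on `ρ`.
  set ξ : (Fin m → Z) → ℝ := fun s => ∫ h, Real.exp (G (h, s)) ∂π with hξ
  have hξm : Measurable ξ :=
    (StronglyMeasurable.integral_prod_left' (μ := π) hGm.exp.stronglyMeasurable).measurable
  have hξ1 : ∫ s, ξ s ∂P ≤ 1 := by
    rw [hξ, ← integral_integral_swap (f := fun h s => Real.exp (G (h, s))) hEi]
    exact (integral_mono_of_nonneg
      (.of_forall fun h => integral_nonneg fun s => by positivity) (integrable_const (1 : ℝ))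
      (.of_forall hmgf)).trans (by simp)
  have hξi : Integrable ξ P := hEi.integral_prod_right
  refine ⟨{s | ξ s < 1 / ε}, measurableSet_lt hξm measurable_const, ?_, ?_⟩
  · have hmarkov := mul_meas_ge_le_integral_of_nonneg (μ := P) (f := ξ)
      (.of_forall fun s => integral_nonneg fun h => by positivity) hξi (1 / ε)
    have : {s | ξ s < 1 / ε}ᶜ = {s | 1 / ε ≤ ξ s} := by ext s; simp
    rw [this]
    have h2 := hmarkov.trans hξ1
    rw [one_div, inv_mul_le_iff₀ hε] at h2
    rw [one_div]
    linarith
  · intro s hs ρ hρ hkl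
    have hGs : Measurable fun h => G (h, s) := hGm.comp measurable_prodMk_right
    have hEs : Integrable (fun h => Real.exp (G (h, s))) π :=
      integrable_of_abs_le hGs.exp fun h => hEb _
    have hdv := integral_le_klDiv_add_log_integral_exp hkl
      (integrable_of_abs_le hGs fun h => hGb _) hEs
    have hlog : Real.log (∫ h, Real.exp (G (h, s)) ∂π) ≤ Real.log (1 / ε) :=
      Real.log_le_log (integral_exp_pos hEs) (le_of_lt hs)
    have hRi : Integrable R ρ :=
      integrable_of_abs_le hRm (B := 1) fun h => abs_le.2 ⟨by linarith [hR0 h], hR1 h⟩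
    have hSi : Integrable (fun h => ∑ i, g h (s i)) ρ :=
      integrable_of_abs_le (hsm.comp measurable_prodMk_right) (B := m) fun h =>
        abs_le.2 ⟨by simpa using (neg_nonpos.2 hmR.le).trans (hsum0 h s), hsum1 h s⟩
    have hint : ∫ h, G (h, s) ∂ρ =
        a * (m * γ * ∫ h, R h ∂ρ - ∫ h, ∑ i, g h (s i) ∂ρ) := by
      simp only [hG]
      rw [integral_const_mul, integral_sub (hRi.const_mul _) hSi, integral_const_mul]
    rw [hint] at hdv
    rw [integral_const_mul]
    set I := ∫ h, R h ∂ρ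
    set J := ∫ h, ∑ i, g h (s i) ∂ρ
    have hfin : 1 / γ * (1 / (m : ℝ) * J) +
        ((klDiv ρ π).toReal + Real.log (1 / ε)) / (2 * γ * (1 - γ) * m) =
        (a * J + ((klDiv ρ π).toReal + Real.log (1 / ε))) / (a * m * γ) := by
      have : 1 - γ ≠ 0 := by linarith
      rw [ha]; field_simp
    rw [hfin, le_div_iff₀ (by positivity)]
    linarith

/-! ### Mean embeddings and their concentration. -/

section FeatureMap

variable {Ω H : Type*} [MeasurableSpace Ω] [NormedAddCommGroup H] [InnerProductSpace ℝ H]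

omit [MeasurableSpace Ω] in
theorem norm_add_sum_sq (φ : Ω → H) {n : ℕ} (v : H) (x : Fin n → Ω) :
    ‖v + ∑ i, φ (x i)‖ ^ 2 =
      ‖v‖ ^ 2 + 2 * ∑ i, ⟪v, φ (x i)⟫ + ∑ i, ∑ j, ⟪φ (x i), φ (x j)⟫ := by
  rw [norm_add_sq_real, inner_sum, ← real_inner_self_eq_norm_sq (∑ i, φ (x i)), sum_inner]
  simp_rw [inner_sum]

variable {φ : Ω → H} (hφφ : Measurable fun p : Ω × Ω => ⟪φ p.1, φ p.2⟫)
  (hφ : ∀ v, Measurable fun x => ⟪v, φ x⟫)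

-- The map `φ` is measurable only through inner products and `H` need not be separable, so
-- measurability is read off the expanded square.
include hφφ hφ in
theorem measurable_norm_add_sum {n : ℕ} (v : H) :
    Measurable fun x : Fin n → Ω => ‖v + ∑ i, φ (x i)‖ := by
  have : (fun x : Fin n → Ω => ‖v + ∑ i, φ (x i)‖) = fun x => √(‖v + ∑ i, φ (x i)‖ ^ 2) := by
    ext x; rw [Real.sqrt_sq (norm_nonneg _)]
  rw [this]
  simp_rw [norm_add_sum_sq φ v]
  refine (((measurable_const).add (.const_mul (Finset.measurable_sum _ fun i _ =>
    (hφ v).comp (measurable_pi_apply i)) _)).add (Finset.measurable_sum _ fun i _ =>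
      Finset.measurable_sum _ fun j _ => ?_)).sqrt
  exact hφφ.comp (f := fun x : Fin n → Ω => (x i, x j))
    ((measurable_pi_apply i).prodMk (measurable_pi_apply j))

variable {κ : ℝ} (hκ : ∀ x, ‖φ x‖ ≤ κ)

omit [MeasurableSpace Ω] [InnerProductSpace ℝ H] in
include hκ in
theorem norm_add_sum_le {n : ℕ} (v : H) (x : Fin n → Ω) :
    ‖v + ∑ i, φ (x i)‖ ≤ ‖v‖ + n * κ := by
  refine (norm_add_le _ _).trans ?_
  gcongr
  exact (norm_sum_le _ _).trans ((Finset.sum_le_sum fun i _ => hκ _).trans (by simp))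

omit [MeasurableSpace Ω] in
include hκ in
theorem abs_inner_le_of_norm_le (v : H) (x : Ω) : |⟪v, φ x⟫| ≤ ‖v‖ * κ :=
  (abs_real_inner_le_norm _ _).trans (by gcongr; exact hκ x)

variable (μ : Measure Ω) [IsProbabilityMeasure μ]

include hφ hκ in
/-- The mean embedding of a probability measure under a bounded feature map. -/
theorem exists_mean_embedding [CompleteSpace H] : ∃ u : H, ∀ v, ∫ x, ⟪v, φ x⟫ ∂μ = ⟪v, u⟫ := by
  have hi : ∀ v, Integrable (fun x => ⟪v, φ x⟫) μ := fun v =>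
    integrable_of_abs_le (hφ v) (abs_inner_le_of_norm_le hκ v)
  -- The embedding is a weak integral given by Riesz representation, which needs no strong
  -- measurability of `φ`.
  let F : H →ₗ[ℝ] ℝ :=
    { toFun := fun v => ∫ x, ⟪v, φ x⟫ ∂μ
      map_add' := fun v w => by simp_rw [inner_add_left]; exact integral_add (hi v) (hi w)
      map_smul' := fun r v => by
        simp_rw [real_inner_smul_left]; rw [integral_const_mul]; rfl }
  let F' : H →L[ℝ] ℝ := F.mkContinuous κ fun v => by
    refine (norm_integral_le_of_norm_le_const (C := ‖v‖ * κ)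
      (.of_forall (abs_inner_le_of_norm_le hκ v))).trans ?_
    simp [mul_comm]
  refine ⟨(InnerProductSpace.toDual ℝ H).symm F', fun v => ?_⟩
  rw [real_inner_comm, InnerProductSpace.toDual_symm_apply]
  rfl

variable {u : H} (hu : ∀ v, ∫ x, ⟪v, φ x⟫ ∂μ = ⟪v, u⟫)

-- Centred independent terms have no cross terms on average. The free offset `v` drives the
-- induction: a first sample `a` replaces `v` by `v - u + φ a`.
include hφφ hφ hκ hu in
theorem integral_norm_sub_add_sum_sq_le {n : ℕ} (v : H) :
    ∫ x, ‖v - (n : ℝ) • u + ∑ i, φ (x i)‖ ^ 2 ∂(Measure.pi fun _ : Fin n => μ) ≤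
      ‖v‖ ^ 2 + n * κ ^ 2 := by
  induction n generalizing v with
  | zero => simp
  | succ n ih =>
    have hm := (measurable_norm_add_sum hφφ hφ (n := n + 1) (v - ((n + 1 : ℕ) : ℝ) • u)).pow_const 2
    have hint : Integrable (fun x : Fin (n + 1) → Ω =>
        ‖v - ((n + 1 : ℕ) : ℝ) • u + ∑ i, φ (x i)‖ ^ 2) (Measure.pi fun _ => μ) :=
      integrable_of_abs_le hm fun x => by
        rw [abs_of_nonneg (by positivity)]
        exact pow_le_pow_left₀ (norm_nonneg _) (norm_add_sum_le hκ _ x) 2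
    rw [integral_pi_fin_succ μ hm hint]
    have hexp : ∀ a, ‖v - u + φ a‖ ^ 2 = ‖v - u‖ ^ 2 + 2 * ⟪v - u, φ a⟫ + ‖φ a‖ ^ 2 :=
      fun a => norm_add_sq_real _ _
    have hi : Integrable (fun a => ⟪v - u, φ a⟫) μ :=
      integrable_of_abs_le (hφ _) (abs_inner_le_of_norm_le hκ _)
    have hκi : Integrable (fun a => ‖v - u‖ ^ 2 + 2 * ⟪v - u, φ a⟫ + κ ^ 2 + n * κ ^ 2) μ :=
      (((integrable_const _).add (hi.const_mul 2)).add (integrable_const _)).add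
        (integrable_const _)
    have hvec : ∀ (a : Ω) (x : Fin n → Ω), v - ((n + 1 : ℕ) : ℝ) • u +
        ∑ i, φ ((Fin.cons a x : Fin (n + 1) → Ω) i) =
        (v - u + φ a) - (n : ℝ) • u + ∑ i, φ (x i) := by
      intro a x
      simp only [Fin.sum_univ_succ, Fin.cons_zero, Fin.cons_succ]
      push_cast
      module
    simp_rw [hvec]
    refine (integral_mono_of_nonneg (.of_forall fun a => integral_nonneg fun x => by positivity)
      hκi (.of_forall fun a => ?_)).trans ?_
    · refine (ih (v - u + φ a)).trans ?_
      rw [hexp]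
      have := pow_le_pow_left₀ (norm_nonneg _) (hκ a) 2
      linarith
    · rw [integral_add (by fun_prop) (integrable_const _),
        integral_add (by fun_prop) (integrable_const _),
        integral_add (integrable_const _) (hi.const_mul 2), integral_const_mul, hu]
      simp only [integral_const, probReal_univ, one_smul]
      have h1 : ‖v - u‖ ^ 2 + 2 * ⟪v - u, u⟫ = ‖v‖ ^ 2 - ‖u‖ ^ 2 := by
        rw [norm_sub_sq_real, inner_sub_left, real_inner_self_eq_norm_sq]; ring
      push_cast
      nlinarith [sq_nonneg ‖u‖]

-- The second-moment bound at `v = 0`, with Jensen's inequality in the form of nonnegative variance.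
include hφφ hφ hκ hu in
theorem integral_norm_sum_sub_le {n : ℕ} :
    ∫ x, ‖-((n : ℝ) • u) + ∑ i, φ (x i)‖ ∂(Measure.pi fun _ : Fin n => μ) ≤ √n * κ := by
  have hκ0 : 0 ≤ κ := by
    obtain ⟨x⟩ := nonempty_of_isProbabilityMeasure μ
    exact (norm_nonneg _).trans (hκ x)
  have h := integral_norm_sub_add_sum_sq_le hφφ hφ hκ μ hu (n := n) 0
  have hm := measurable_norm_add_sum hφφ hφ (n := n) (-((n : ℝ) • u))
  have hb := norm_add_sum_le hκ (n := n) (-((n : ℝ) • u))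
  simp only [zero_sub, norm_zero, ne_eq, OfNat.ofNat_ne_zero, not_false_eq_true, zero_pow,
    zero_add] at h
  set P := Measure.pi fun _ : Fin n => μ
  set N : (Fin n → Ω) → ℝ := fun x => ‖-((n : ℝ) • u) + ∑ i, φ (x i)‖
  have hL : MemLp N 2 P := .of_bound hm.aestronglyMeasurable _ (.of_forall fun x => by
    simpa [N] using hb x)
  have hv := variance_nonneg N P
  rw [variance_eq_sub hL] at hv
  refine le_of_sq_le_sq ?_ (by positivity)
  rw [mul_pow, Real.sq_sqrt (by positivity)]
  simp only [Pi.pow_apply] at hv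
  linarith

include hφφ hφ hκ hu in
/-- Concentration of the empirical mean embedding, for feature vectors with nonnegative inner
products. -/
theorem measure_norm_sum_sub_gt_le (hpos : ∀ x y, 0 ≤ ⟪φ x, φ y⟫) {n : ℕ} (hn : 0 < n)
    {s : ℝ} (hs : 0 ≤ s) :
    (Measure.pi fun _ : Fin n => μ).real
      {x | √n * κ * (1 + s) < ‖-((n : ℝ) • u) + ∑ i, φ (x i)‖} ≤ Real.exp (-s ^ 2) := by
  have hκ0 : 0 ≤ κ := by
    obtain ⟨x⟩ := nonempty_of_isProbabilityMeasure μ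
    exact (norm_nonneg _).trans (hκ x)
  have hmean := integral_norm_sum_sub_le hφφ hφ hκ μ hu (n := n)
  have hm := measurable_norm_add_sum hφφ hφ (n := n) (-((n : ℝ) • u))
  have hb := norm_add_sum_le hκ (n := n) (-((n : ℝ) • u))
  have hnR : (0 : ℝ) < n := by exact_mod_cast hn
  -- At `κ = 0` the sub-Gaussian exponent would be `0 / 0`; there every feature vanishes and the
  -- event is empty.
  rcases hκ0.eq_or_lt with rfl | hκpos
  · have hφ0 : ∀ x, φ x = 0 := fun x => norm_le_zero_iff.1 (hκ x)
    have hu0 : u = 0 := by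
      have := hu u
      simpa [hφ0, eq_comm] using this
    simp [hφ0, hu0, Real.exp_nonneg]
  -- Nonnegative inner products improve the diameter from `2 κ` to `√2 κ`, which makes the tail
  -- exactly `exp (-s²)`.
  have hdiff : ∀ x y, ‖φ x - φ y‖ ≤ √2 * κ := by
    intro x y
    refine le_of_sq_le_sq ?_ (by positivity)
    rw [norm_sub_sq_real, mul_pow, Real.sq_sqrt (by norm_num)]
    have h1 := pow_le_pow_left₀ (norm_nonneg _) (hκ x) 2
    have h2 := pow_le_pow_left₀ (norm_nonneg _) (hκ y) 2
    linarith [hpos x y]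
  have hsub := hasSubgaussianMGF_of_boundedDifferences μ ⟨√2 * κ, by positivity⟩ hm
    (B := ‖-((n : ℝ) • u)‖ + n * κ) (fun x => by rw [abs_norm]; exact hb x) (fun x i a => by
      refine (abs_norm_sub_norm_le _ _).trans ?_
      have : (-((n : ℝ) • u) + ∑ j, φ (Function.update x i a j)) -
          (-((n : ℝ) • u) + ∑ j, φ (x j)) = φ a - φ (x i) := by
        rw [add_sub_add_left_eq_sub, ← Finset.sum_sub_distrib,
          Finset.sum_eq_single i (fun j _ hj => by simp [hj]) (by simp)]
        simp
      rw [this]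
      exact hdiff _ _)
  have h := hsub.measure_ge_le (ε := √n * κ * s) (by positivity)
  refine (measureReal_mono (fun x hx => ?_)).trans (h.trans (le_of_eq ?_))
  · simp only [Set.mem_ofPred_eq] at hx ⊢
    linarith
  · congr 1
    push_cast
    rw [mul_pow, mul_pow, Real.sq_sqrt hnR.le]
    change -(n * κ ^ 2 * s ^ 2) / (2 * (n * (√2 * κ / 2) ^ 2)) = _
    rw [div_pow, mul_pow, Real.sq_sqrt (by norm_num)]
    field_simp

end FeatureMap

/-! ### Reproducing kernels and risks. -/

namespace DomainAdaptation

section RKHS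

variable {X L : Type*} [NormedAddCommGroup L] [InnerProductSpace ℝ L]
  [CompleteSpace L] [RKHS ℝ L X ℝ]

variable (L) in
/-- The canonical feature map `x ↦ k(·, x)` of a reproducing kernel Hilbert space. -/
noncomputable def featureMap (x : X) : L := RKHS.kerFun L x 1

theorem inner_featureMap (f : L) (x : X) : ⟪f, featureMap L x⟫ = f x := by
  simp [featureMap]

theorem inner_featureMap_featureMap (x y : X) :
    ⟪featureMap L x, featureMap L y⟫ = reproducingKernel L x y := by
  rw [real_inner_comm, inner_featureMap, featureMap, RKHS.kerFun_apply]
  rfl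

theorem norm_featureMap_le {K : ℝ} (hK : ∀ x : X, reproducingKernel L x x ≤ K) (x : X) :
    ‖featureMap L x‖ ≤ √K := by
  apply Real.le_sqrt_of_sq_le
  rw [← real_inner_self_eq_norm_sq, inner_featureMap_featureMap]
  exact hK x

/-- The elements of a reproducing kernel Hilbert space with a measurable kernel are measurable. -/
theorem measurable_of_measurable_reproducingKernel [MeasurableSpace X]
    (hk : Measurable (Function.uncurry (reproducingKernel (X := X) L))) (f : L) :
    Measurable f := by
  -- Kernel sections span a dense subspace, and norm limits are pointwise limits because evaluation
  -- is continuous.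
  have hmem : f ∈ (Submodule.span ℝ {RKHS.kerFun L x v | (x : X) (v : ℝ)}).topologicalClosure := by
    rw [RKHS.kerFun_dense]; trivial
  obtain ⟨F, hF, hlim⟩ := mem_closure_iff_seq_limit.1 hmem
  have hspan : ∀ g ∈ Submodule.span ℝ {RKHS.kerFun L x v | (x : X) (v : ℝ)}, Measurable g := by
    intro g hg
    induction hg using Submodule.span_induction with
    | mem g hg =>
      obtain ⟨x, v, rfl⟩ := hg
      have : ⇑(RKHS.kerFun L x v) = fun y => v * reproducingKernel L y x := by
        ext y
        have hv : v = v • (1 : ℝ) := by simp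
        rw [RKHS.kerFun_apply, reproducingKernel]
        conv_lhs => rw [hv, map_smul]
        rfl
      rw [this]
      exact (hk.comp (f := fun y => (y, x)) measurable_prodMk_right).const_mul v
    | zero => rw [RKHS.coe_zero]; exact measurable_const
    | add g g' _ _ hg hg' => rw [RKHS.coe_add]; exact hg.add hg'
    | smul c g _ hg => rw [RKHS.coe_smul]; exact hg.const_smul c
  exact measurable_of_tendsto_metrizable (fun n => hspan _ (hF n)) (tendsto_pi_nhds.2 fun x =>
    ((RKHS.continuous_eval x).tendsto f).comp hlim)

theorem empMMD_eq_norm {m : ℕ} (x x' : Fin m → X) :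
    empMMD (reproducingKernel L) x x' =
      ‖(1 / (m : ℝ)) • ∑ i, featureMap L (x i) - (1 / (m : ℝ)) • ∑ i, featureMap L (x' i)‖ := by
  rw [← smul_sub, ← Real.sqrt_sq (norm_nonneg (_ • _)), empMMD]
  congr 1
  rw [norm_smul, mul_pow, Real.norm_eq_abs, sq_abs, norm_sub_sq_real,
    ← real_inner_self_eq_norm_sq, ← real_inner_self_eq_norm_sq]
  simp_rw [sum_inner, inner_sum, inner_featureMap_featureMap]
  ring

end RKHS

section Risk

variable {X Y : Type*} [MeasurableSpace X] [MeasurableSpace Y]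

/-- With a common `κ`, the two risks differ only through the input marginals. -/
theorem risk_eq_integral_pointwiseLoss {ℓ : Y → Y → ℝ} {D : Measure (X × Y)}
    [IsProbabilityMeasure D] {κ : Kernel X Y} [IsMarkovKernel κ] (hD : D = D.fst ⊗ₘ κ) {h : X → Y}
    (hint : Integrable (fun z : X × Y => ℓ (h z.1) z.2) D) :
    risk ℓ D h = ∫ x, pointwiseLoss ℓ κ h x ∂D.fst := by
  rw [risk]
  conv_lhs => rw [hD]
  exact Measure.integral_compProd (by rwa [← hD])

end Risk

end DomainAdaptation

/-! ### Assembling the bound. -/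

theorem norm_sub_le_of_norm_nsmul_sub_le {H : Type*} [NormedAddCommGroup H] [NormedSpace ℝ H]
    {m : ℕ} (hm : 0 < m) {u s : H} {r : ℝ} (h : ‖-((m : ℝ) • u) + s‖ ≤ m * r) :
    ‖(1 / (m : ℝ)) • s - u‖ ≤ r := by
  have hmR : (0 : ℝ) < m := by exact_mod_cast hm
  have : -((m : ℝ) • u) + s = (m : ℝ) • ((1 / (m : ℝ)) • s - u) := by
    rw [smul_sub, smul_smul, mul_one_div_cancel hmR.ne', one_smul]; abel
  rw [this, norm_smul, Real.norm_of_nonneg hmR.le] at h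
  exact le_of_mul_le_mul_left h hmR

theorem mainTheorem2 {X Y ℋ L : Type*} [MeasurableSpace X] [MeasurableSpace Y] [MeasurableSpace ℋ]
    -- the hypothesis class and the loss
    (ev : ℋ → X → Y) (hev : Measurable (Function.uncurry ev))
    (ℓ : Y → Y → ℝ) (hℓ : Measurable (Function.uncurry ℓ))
    (hℓ01 : ∀ y y', 0 ≤ ℓ y y' ∧ ℓ y y' ≤ 1)
    -- the source and target domains
    (S T : Measure (X × Y)) [IsProbabilityMeasure S] [IsProbabilityMeasure T]
    (κ : Kernel X Y) [IsMarkovKernel κ] (hshift : DomainAdaptation.CovariateShift S T κ)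
    -- the reproducing kernel Hilbert space and its bounded kernel
    [NormedAddCommGroup L] [InnerProductSpace ℝ L] [CompleteSpace L] [RKHS ℝ L X ℝ]
    (hk : Measurable (Function.uncurry (DomainAdaptation.reproducingKernel (X := X) L)))
    (K : ℝ) (hkK : ∀ x x' : X, 0 ≤ DomainAdaptation.reproducingKernel L x x' ∧
      DomainAdaptation.reproducingKernel L x x' ≤ K)
    -- every expected pointwise loss is represented in the unit ball of `L`
    (hL : ∀ h : ℋ, ∃ f : L, ‖f‖ ≤ 1 ∧
      ∀ᵐ x ∂(S.fst + T.fst), DomainAdaptation.pointwiseLoss ℓ κ (ev h) x = f x)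
    -- the prior and the parameters
    (π : Measure ℋ) [IsProbabilityMeasure π]
    (m : ℕ) (hm : 0 < m) (γ δ : ℝ) (hγ : γ ∈ Set.Ioo (0 : ℝ) 1) (hδ : δ ∈ Set.Ioo (0 : ℝ) 1) :
    ∃ E : Set ((Fin m → X × Y) × (Fin m → X)), MeasurableSet E ∧
      ENNReal.ofReal (1 - δ) ≤
        ((Measure.pi fun _ : Fin m => S).prod (Measure.pi fun _ : Fin m => T.fst)) E ∧
      ∀ ω ∈ E, ∀ ρ : Measure ℋ, IsProbabilityMeasure ρ → klDiv ρ π ≠ ⊤ →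
        DomainAdaptation.gibbsRisk ev ℓ T ρ ≤
          1 / γ * DomainAdaptation.empGibbsRisk ev ℓ ω.1 ρ
          + ((klDiv ρ π).toReal + Real.log (2 / δ)) / (2 * γ * (1 - γ) * m)
          + DomainAdaptation.empMMD (DomainAdaptation.reproducingKernel L)
              (fun i => (ω.1 i).1) ω.2
          + 2 * √(K / m) * (2 + √(Real.log (4 / δ))) := by
  obtain ⟨hγ0, hγ1⟩ := hγ
  obtain ⟨hδ0, hδ1⟩ := hδ
  have hmR : (0 : ℝ) < m := by exact_mod_cast hm
  set φ : X → L := DomainAdaptation.featureMap L with hφdef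
  have hφφ : Measurable fun p : X × X => ⟪φ p.1, φ p.2⟫ := by
    simp_rw [hφdef, DomainAdaptation.inner_featureMap_featureMap]
    exact hk
  have hφ : ∀ v : L, Measurable fun x => ⟪v, φ x⟫ := fun v => by
    simp_rw [hφdef, DomainAdaptation.inner_featureMap]
    exact DomainAdaptation.measurable_of_measurable_reproducingKernel hk v
  have hκ : ∀ x, ‖φ x‖ ≤ √K :=
    DomainAdaptation.norm_featureMap_le fun x => (hkK x x).2
  have hpos : ∀ x y, 0 ≤ ⟪φ x, φ y⟫ := fun x y => by
    rw [hφdef, DomainAdaptation.inner_featureMap_featureMap]; exact (hkK x y).1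
  obtain ⟨uS, huS⟩ := exists_mean_embedding hφ hκ S.fst
  obtain ⟨uT, huT⟩ := exists_mean_embedding hφ hκ T.fst
  -- Each embedding tail `exp (-s²)` equals `δ / 4`; the PAC-Bayes event takes the remaining `δ /
  -- 2`.
  set s := √(Real.log (4 / δ)) with hs
  have hexp : Real.exp (-s ^ 2) = δ / 4 := by
    rw [hs, Real.sq_sqrt (Real.log_nonneg (by rw [le_div_iff₀ hδ0]; linarith)),
      ← Real.log_inv, Real.exp_log (by positivity), inv_div]
  set g : ℋ → X × Y → ℝ := fun h z => ℓ (ev h z.1) z.2 with hg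
  have hgm : Measurable (Function.uncurry g) := by
    have h1 : Measurable fun p : ℋ × X × Y => ev p.1 p.2.1 :=
      hev.comp (measurable_fst.prodMk (measurable_fst.comp measurable_snd))
    exact hℓ.comp (h1.prodMk (measurable_snd.comp measurable_snd))
  obtain ⟨A, hA, hAS, hAρ⟩ := exists_pacBayes_event S π hgm (fun _ _ => (hℓ01 _ _).1)
    (fun _ _ => (hℓ01 _ _).2) hm hγ0 hγ1 (half_pos hδ0)
  set N : L → (Fin m → X) → ℝ := fun u x => ‖-((m : ℝ) • u) + ∑ i, φ (x i)‖ with hN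
  have hNm : ∀ u, Measurable (N u) := fun u => measurable_norm_add_sum hφφ hφ _
  set r := √m * √K * (1 + s) with hr
  have hBmeas : ∀ u, MeasurableSet {x | r < N u x} := fun u =>
    measurableSet_lt measurable_const (hNm u)
  have hBS := measure_norm_sum_sub_gt_le hφφ hφ hκ S.fst huS hpos hm (s := s) (Real.sqrt_nonneg _)
  have hBT := measure_norm_sum_sub_gt_le hφφ hφ hκ T.fst huT hpos hm (s := s) (Real.sqrt_nonneg _)
  rw [hexp] at hBS hBT
  set PS := Measure.pi fun _ : Fin m => S with hPS
  set PT := Measure.pi fun _ : Fin m => T.fst with hPT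
  have hfst : MeasurePreserving (fun (w : Fin m → X × Y) i => (w i).1) PS
      (Measure.pi fun _ : Fin m => S.fst) :=
    measurePreserving_pi (fun _ : Fin m => S) (fun _ => S.fst) fun _ =>
      ⟨measurable_fst, rfl⟩
  -- `E₁` and `E₂` involve the same source sample, which is harmless in a union bound.
  set E₁ : Set ((Fin m → X × Y) × (Fin m → X)) := Prod.fst ⁻¹' Aᶜ
  set E₂ : Set ((Fin m → X × Y) × (Fin m → X)) :=
    Prod.fst ⁻¹' ((fun w i => (w i).1) ⁻¹' {x | r < N uS x})
  set E₃ : Set ((Fin m → X × Y) × (Fin m → X)) := Prod.snd ⁻¹' {x | r < N uT x}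
  have hE₁ : MeasurableSet E₁ := measurable_fst hA.compl
  have hE₂ : MeasurableSet E₂ := measurable_fst (hfst.measurable (hBmeas uS))
  have hE₃ : MeasurableSet E₃ := measurable_snd (hBmeas uT)
  refine ⟨(E₁ ∪ E₂ ∪ E₃)ᶜ, ((hE₁.union hE₂).union hE₃).compl, ?_, ?_⟩
  · have h1 : (PS.prod PT).real E₁ ≤ δ / 2 := by
      rw [measurePreserving_fst.measureReal_preimage hA.compl.nullMeasurableSet]
      exact hAS
    have h2 : (PS.prod PT).real E₂ ≤ δ / 4 := by
      rw [measurePreserving_fst.measureReal_preimage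
          (hfst.measurable (hBmeas uS)).nullMeasurableSet,
        hfst.measureReal_preimage (hBmeas uS).nullMeasurableSet]
      exact hBS
    have h3 : (PS.prod PT).real E₃ ≤ δ / 4 := by
      rw [measurePreserving_snd.measureReal_preimage (hBmeas uT).nullMeasurableSet]
      exact hBT
    have hunion : (PS.prod PT).real (E₁ ∪ E₂ ∪ E₃) ≤ δ := by
      have := measureReal_union_le (μ := PS.prod PT) (E₁ ∪ E₂) E₃
      have := measureReal_union_le (μ := PS.prod PT) E₁ E₂
      linarith
    rw [← ofReal_measureReal (μ := PS.prod PT) (s := (E₁ ∪ E₂ ∪ E₃)ᶜ)]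
    apply ENNReal.ofReal_le_ofReal
    rw [probReal_compl_eq_one_sub ((hE₁.union hE₂).union hE₃)]
    linarith
  · rintro ⟨w, x'⟩ hω ρ hρ hkl
    simp only [Set.mem_compl_iff, Set.mem_union, not_or] at hω
    obtain ⟨⟨hω1, hω2⟩, hω3⟩ := hω
    have hwA : w ∈ A := not_not.1 hω1
    have hwS : N uS (fun i => (w i).1) ≤ r := not_lt.1 hω2
    have hwT : N uT x' ≤ r := not_lt.1 hω3
    have hpac := hAρ w hwA ρ hρ hkl
    rw [one_div_div] at hpac
    have hrm : r = m * (√(K / m) * (1 + s)) := by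
      rw [hr, Real.sqrt_div' _ hmR.le]
      have : √(m : ℝ) ≠ 0 := (Real.sqrt_pos.2 hmR).ne'
      field_simp
      rw [Real.sq_sqrt hmR.le]
      ring
    have hdS := norm_sub_le_of_norm_nsmul_sub_le hm (hwS.trans_eq hrm)
    have hdT := norm_sub_le_of_norm_nsmul_sub_le hm (hwT.trans_eq hrm)
    have hmmd : ‖uT - uS‖ ≤ DomainAdaptation.empMMD (DomainAdaptation.reproducingKernel L)
        (fun i => (w i).1) x' + 2 * (√(K / m) * (1 + s)) := by
      rw [DomainAdaptation.empMMD_eq_norm]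
      set a := (1 / (m : ℝ)) • ∑ i, φ (w i).1
      set b := (1 / (m : ℝ)) • ∑ i, φ (x' i)
      have : uT - uS = -(b - uT) + -(a - b) + (a - uS) := by abel
      rw [this]
      refine (norm_add₃_le).trans ?_
      rw [norm_neg, norm_neg]
      linarith
    have hgi : ∀ (D : Measure (X × Y)) [IsProbabilityMeasure D] (h : ℋ), Integrable (g h) D :=
      fun D _ h => integrable_of_abs_le (hgm.comp measurable_prodMk_left) (B := 1) fun z =>
        abs_le.2 ⟨by linarith [(hℓ01 (ev h z.1) z.2).1], (hℓ01 _ _).2⟩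
    have hrisk : ∀ h, DomainAdaptation.risk ℓ T (ev h) ≤
        DomainAdaptation.risk ℓ S (ev h) + ‖uT - uS‖ := by
      intro h
      obtain ⟨f, hf1, hf⟩ := hL h
      rw [ae_add_measure_iff] at hf
      rw [DomainAdaptation.risk_eq_integral_pointwiseLoss hshift.source (hgi S h),
        DomainAdaptation.risk_eq_integral_pointwiseLoss hshift.target (hgi T h),
        integral_congr_ae hf.1, integral_congr_ae hf.2]
      -- The reproducing property turns both integrals into inner products with mean embeddings; `f`
      -- depends on `h`, but the resulting bound does not.
      have hfφ : ∀ x, f x = ⟪f, φ x⟫ := fun x => (DomainAdaptation.inner_featureMap f x).symm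
      simp_rw [hfφ]
      rw [huS, huT]
      have h1 : ⟪f, uT - uS⟫ ≤ ‖uT - uS‖ :=
        (real_inner_le_norm _ _).trans (mul_le_of_le_one_left (norm_nonneg _) hf1)
      rw [inner_sub_right] at h1
      linarith
    have hri : ∀ (D : Measure (X × Y)) [IsProbabilityMeasure D],
        Integrable (fun h => DomainAdaptation.risk ℓ D (ev h)) ρ := fun D _ =>
      integrable_of_abs_le (B := 1) (hgm.stronglyMeasurable.integral_prod_right).measurable
        fun h => by
          rw [DomainAdaptation.risk, abs_of_nonneg (integral_nonneg fun z => (hℓ01 _ _).1)]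
          exact (integral_mono (hgi D h) (integrable_const (1 : ℝ)) fun z =>
            (hℓ01 _ _).2).trans (by simp)
    have hgibbs : DomainAdaptation.gibbsRisk ev ℓ T ρ ≤
        DomainAdaptation.gibbsRisk ev ℓ S ρ + ‖uT - uS‖ := by
      refine (integral_mono (hri T) ((hri S).add (integrable_const ‖uT - uS‖)) hrisk).trans_eq ?_
      rw [integral_add' (hri S) (integrable_const _)]
      simp [DomainAdaptation.gibbsRisk]
    -- The argument yields the factor `1 + s`; nonnegativity of the root relaxes it to the stated `2
    -- + s`.
    have hslack : 0 ≤ √(K / m) := Real.sqrt_nonneg _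
    change DomainAdaptation.gibbsRisk ev ℓ S ρ ≤
      1 / γ * DomainAdaptation.empGibbsRisk ev ℓ w ρ + _ at hpac
    linarith
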